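/- Let $T$ be a finite rooted tree that recursively partitions $I=\{1,\dots,n\}$: every node $i$ carries a subset $I_i\subseteq I$, the root carries $I$, and for every nonleaf node $p$ the set $I_p$ is the disjoint union of the sets $I_i$ over the children $i$ of $p$. Let $r$ be a positive integer. A matrix $M\in\mathbb{R}^{n\times n}$ is called recursively low-rank with partitioning tree $T$ and integer $r$, with factors $U_i,V_i\in\mathbb{R}^{|I_i|\times r}$ ($i$ nonroot), $\Sigma_p\in\mathbb{R}^{r\times r}$ ($p$ nonleaf) and $W_q,Z_q\in\mathbb{R}^{r\times r}$ ($q$ neither leaf nor root), if (1) $M(I_i,I_j)=U_i\Sigma_pV_j^T$ for any two distinct siblings $i,j$ with parent $p$, and (2) $U_p(I_i,:)=U_iW_p$ and $V_p(I_i,:)=V_iZ_p$ for every nonroot nonleaf node $p$ and every child $i$ of $p$. Let $A$ be symmetric positive definite and recursively low-rank with partitioning tree $T$ and integer $r$, with factors $U_i,\,V_i=U_i,\,\Sigma_p,\,W_q,\,Z_q=W_q$, and suppose that $A(I_i,I_i)-U_i\Sigma_pU_i^T$ is symmetric positive definite for every nonroot node $i$ with parent $p$. Then there is a matrix $G$,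 recursively low-rank with the same tree $T$ and the same integer $r$, with factors $U_i,V_i,\Omega_p,W_q,Z_q$ (where the $U_i$ and $W_q$ are those of $A$), such that \[A=GG^T.\] Moreover, if all $\Sigma_p$ ($p$ nonleaf) are symmetric, then $G$ can be chosen together with symmetric matrices $D_p\in\mathbb{R}^{r\times r}$, one for each nonleaf node $p$, that solve the algebraic Riccati equations \[\Lambda_p=D_p+D_p^T+D_p\Xi_pD_p^T,\qquad \Xi_p=\sum_{i\text{ child of }p}V_i^TV_i,\] where $\Lambda_p=\Sigma_p$ if $p$ is the root and $\Lambda_p=\Sigma_p-W_p\Sigma_qW_p^T$ if $p$ has parent $q$, and that satisfy $\Omega_p=D_p$ if $p$ is the root, and $W_p=(I+D_p\Xi_p)Z_p$ and $\Omega_p=D_p+W_p\Omega_qZ_p^T$ if $p$ is a nonroot nonleaf node with parent $q$. -/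

import Mathlib

/-- A finite rooted tree with node set `N` that recursively partitions the index set
`{1, …, n}`, modelled by `Fin n`. Every node carries a subset of the index set. -/
structure PartitionTree (N : Type*) (n : ℕ) where
  /-- the root of the tree -/
  root : N
  /-- the parent of a node; by convention the root is sent to itself -/
  parent : N → N
  parent_root : parent root = root
  /-- every node is connected to the root by the path of its ancestors -/
  reaches_root : ∀ i, ∃ k : ℕ, parent^[k] i = root
  /-- the index subset that belongs to a node -/
  index : N → Finset (Fin n)
  index_root : index root = Finset.univ
  /-- the index subset of a nonleaf node is the union of those of its children -/
  mem_index_iff : ∀ p, (∃ i, i ≠ root ∧ parent i = p) →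
    ∀ x, x ∈ index p ↔ ∃ i, (i ≠ root ∧ parent i = p) ∧ x ∈ index i
  /-- the index subsets of distinct siblings are disjoint -/
  disjoint_siblings : ∀ i j, i ≠ root → j ≠ root → parent i = parent j → i ≠ j →
    Disjoint (index i) (index j)

namespace PartitionTree

variable {N : Type*} {n : ℕ}

/-- `i` is a child of `p`. -/
def IsChild (T : PartitionTree N n) (i p : N) : Prop :=
  i ≠ T.root ∧ T.parent i = p

/-- `i` is a leaf: it has no children. -/
def IsLeaf (T : PartitionTree N n) (p : N) : Prop :=
  ∀ i, ¬ T.IsChild i p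

open Classical in
/-- The set of children of `p`. -/
noncomputable def children [Fintype N] (T : PartitionTree N n) (p : N) : Finset N :=
  Finset.univ.filter fun i => T.IsChild i p

theorem index_subset (T : PartitionTree N n) {i p : N} (h : T.IsChild i p) :
    T.index i ⊆ T.index p :=
  fun x hx => (T.mem_index_iff p ⟨i, h⟩ x).2 ⟨i, h, hx⟩

/-- The inclusion of the index subset of a child in that of its parent. -/
def incl (T : PartitionTree N n) {i p : N} (h : T.IsChild i p) :
    T.index i → T.index p :=
  fun x => ⟨x.1, T.index_subset h x.2⟩

/-- The submatrix of `A` with rows in the index subset of `i` and columns in that of `j`. -/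
def block (T : PartitionTree N n) (A : Matrix (Fin n) (Fin n) ℝ) (i j : N) :
    Matrix (T.index i) (T.index j) ℝ :=
  A.submatrix Subtype.val Subtype.val

/-- The matrix `A` is recursively low-rank with partitioning tree `T` and integer `r`, and
`U`, `V` (the left and right bases), `S` (the middle factors), `W`, `Z` (the left and right
changes of basis) are its factors. The values of `U`, `V`, `W`, `Z` at the root and those of
`S`, `W`, `Z` at the leaves play no role. -/
def HasFactors (T : PartitionTree N n) {r : ℕ} (A : Matrix (Fin n) (Fin n) ℝ)
    (U V : (i : N) → Matrix (T.index i) (Fin r) ℝ)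
    (S W Z : N → Matrix (Fin r) (Fin r) ℝ) : Prop :=
  (∀ i j p, T.IsChild i p → T.IsChild j p → i ≠ j →
    T.block A i j = U i * S p * (V j).transpose) ∧
  (∀ i p, ∀ h : T.IsChild i p, p ≠ T.root →
    (U p).submatrix (T.incl h) id = U i * W p ∧
    (V p).submatrix (T.incl h) id = V i * Z p)

open Classical in
/-- `Λ_p = Σ_p - W_p Σ_q W_pᵀ`, where `q` is the parent of `p`; at the root `Λ_p = Σ_p`. -/
noncomputable def Lam (T : PartitionTree N n) {r : ℕ}
    (S W : N → Matrix (Fin r) (Fin r) ℝ) (p : N) : Matrix (Fin r) (Fin r) ℝ :=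
  if p = T.root then S p else S p - W p * S (T.parent p) * (W p).transpose

/-- `Ξ_p`, the sum of `V_iᵀ V_i` over the children `i` of `p`. -/
noncomputable def Xi [Fintype N] (T : PartitionTree N n) {r : ℕ}
    (V : (i : N) → Matrix (T.index i) (Fin r) ℝ) (p : N) : Matrix (Fin r) (Fin r) ℝ :=
  ∑ i ∈ T.children p, (V i).transpose * V i

end PartitionTree

/-! Write `P_i` for the coordinate projection of node `i`, `q` for its parent, and let `B_i` be
`A(I_i, I_i) - U_i Σ_q U_iᵀ` completed by the identity to an n × n matrix; at the root, `B` is `A`.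
For symmetric `Σ`, the siblings' off-diagonal blocks and the nestedness of the bases give `B_p = E
Eᵀ + U Λ_p Uᵀ`, where `U` is the sum of the children's `U_i` and `E` is block diagonal with square
root factors `F_i` of the children's `B_i` (`reduced_eq`). Put `V_i = F_i⁻¹ U_i` and let `V` be the
sum over the children. Then `E V = U`, so `B_p = E (1 + V Λ_p Vᵀ) Eᵀ`. A solution `D_p` of the
Riccati equation makes `1 + V D_p Vᵀ` a square root factor of the middle matrix
(`exists_symm_riccati`), hence `F_p = E + U D_p Vᵀ` is a factor of `B_p`, again block diagonal plus
low rank. From `F_p V = U (1 + D_p Ξ_p)` the new bases are nested, with `W_p = (1 + D_p Ξ_p) Z_p`.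
The matrix `G` is `F` at the root. Unfolding it down the tree accumulates the low-rank terms in `Ω_p
= D_p + W_p Ω_q Z_pᵀ`. General `Σ_p` reduce to their symmetric parts, which leave all relevant
products unchanged. -/

namespace Matrix

/-! ### Square roots and the Riccati equation. -/

theorem PosDef.exists_symm_sq {m : Type*} [Fintype m] [DecidableEq m] {M : Matrix m m ℝ}
    (hM : M.PosDef) : ∃ H : Matrix m m ℝ, H.PosSemidef ∧ H * H = M := by
  open scoped MatrixOrder in
  exact ⟨CFC.sqrt M, nonneg_iff_posSemidef.1 (CFC.sqrt_nonneg M),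
    CFC.sqrt_mul_sqrt_self M hM.posSemidef.nonneg⟩

theorem posDef_mul_transpose_of_isUnit {m : Type*} [Fintype m] [DecidableEq m]
    {L : Matrix m m ℝ} (hL : IsUnit L) : (L * Lᵀ).PosDef := by
  have h := PosDef.mul_conjTranspose_self L (vecMul_injective_of_isUnit hL)
  rwa [conjTranspose_eq_transpose_of_trivial] at h

theorem isUnit_of_mul_transpose_posDef {m : Type*} [Fintype m] [DecidableEq m]
    {L : Matrix m m ℝ} (hL : (L * Lᵀ).PosDef) : IsUnit L := by
  have h := hL.isUnit
  rw [isUnit_iff_isUnit_det, det_mul, det_transpose] at h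
  rw [isUnit_iff_isUnit_det]
  exact isUnit_of_mul_isUnit_left h

theorem one_add_mul_mul_transpose_sq {m k : Type*} [Fintype m] [DecidableEq m] [Fintype k]
    {L D : Matrix k k ℝ} (V : Matrix m k ℝ) (h : L = D + Dᵀ + D * (Vᵀ * V) * Dᵀ) :
    (1 + V * D * Vᵀ) * (1 + V * D * Vᵀ)ᵀ = 1 + V * L * Vᵀ := by
  rw [h]
  simp only [transpose_add, transpose_one, transpose_mul, transpose_transpose, Matrix.mul_add,
    Matrix.add_mul, Matrix.mul_one, Matrix.one_mul, Matrix.mul_assoc]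
  abel

/-- Sylvester's identity `det (1 + XY) = det (1 + YX)`. This is what allows solving `W = (1 + D Ξ)
Z` for `Z`. -/
theorem isUnit_one_add_mul_gram {m k : Type*} [Fintype m] [DecidableEq m] [Fintype k]
    [DecidableEq k] {D : Matrix k k ℝ} (V : Matrix m k ℝ) (h : IsUnit (1 + V * D * Vᵀ)) :
    IsUnit (1 + D * (Vᵀ * V)) := by
  rw [isUnit_iff_isUnit_det, Matrix.mul_assoc, det_one_add_mul_comm] at h
  rwa [isUnit_iff_isUnit_det, ← Matrix.mul_assoc]

/-- The algebraic Riccati equation `L = D + Dᵀ + D Vᵀ V Dᵀ` with symmetric `L` has a symmetric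
solution if `1 + V L Vᵀ` is positive definite. -/
theorem exists_symm_riccati {m k : Type*} [Fintype m] [DecidableEq m] [Fintype k]
    {L : Matrix k k ℝ} (hL : L.IsSymm) (V : Matrix m k ℝ) (h : (1 + V * L * Vᵀ).PosDef) :
    ∃ D : Matrix k k ℝ, D.IsSymm ∧ L = D + Dᵀ + D * (Vᵀ * V) * Dᵀ := by
  obtain ⟨H, hH, hHH⟩ := h.exists_symm_sq
  have hu : IsUnit (1 + H) := (PosDef.one.add_posSemidef hH).isUnit
  set K := (1 + H)⁻¹ with hK
  have hK1 : K * (1 + H) = 1 := nonsing_inv_mul _ ((isUnit_iff_isUnit_det _).1 hu)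
  have hKt : Kᵀ = K := by
    rw [hK, transpose_nonsing_inv, transpose_add, transpose_one]
    have := hH.isHermitian.eq
    rw [conjTranspose_eq_transpose_of_trivial] at this
    rw [this]
  have hKH : K * H = 1 - K := by rw [← hK1]; noncomm_ring
  have hX : V * L * Vᵀ = H * H - 1 := by rw [hHH]; abel
  -- As `K` and `H` commute, this is `(1 - K)² - K²`.
  have hKKX : K * K * (V * L * Vᵀ) = 1 - 2 • K := by
    rw [hX, Matrix.mul_sub, Matrix.mul_one, ← Matrix.mul_assoc, Matrix.mul_assoc K K H, hKH,
      Matrix.mul_sub, Matrix.mul_one, Matrix.sub_mul, Matrix.mul_assoc K K H, hKH]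
    noncomm_ring
  -- The target is `V D Vᵀ = H - 1`. Since `H - 1 = (H² - 1) K = V L Vᵀ K`, it is natural to ask for
  -- `D Vᵀ = L Vᵀ K`; the equation `2 D = L - D Vᵀ V D` then dictates `D`.
  set D := (1 / 2 : ℝ) • (L - L * Vᵀ * (K * K) * (V * L)) with hD
  have hDt : Dᵀ = D := by
    simp only [hD, transpose_smul, transpose_sub, transpose_mul, transpose_transpose, hKt, hL.eq,
      Matrix.mul_assoc]
  have hDV : D * Vᵀ = L * Vᵀ * K := by
    have : D * Vᵀ = (1 / 2 : ℝ) • (L * Vᵀ * (1 - K * K * (V * L * Vᵀ))) := by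
      simp only [hD, smul_mul, Matrix.sub_mul, Matrix.mul_sub, Matrix.mul_one, Matrix.mul_assoc]
    rw [this, hKKX, sub_sub_cancel, ← Nat.cast_smul_eq_nsmul ℝ, Matrix.mul_smul, smul_smul]
    norm_num
  have hVD : V * D = K * (V * L) := by
    rw [← transpose_inj, transpose_mul, hDt, hDV, transpose_mul, transpose_mul, hKt, hL.eq]
  refine ⟨D, hDt, ?_⟩
  have h2 : D * (Vᵀ * V) * D = L * Vᵀ * (K * K) * (V * L) := by
    rw [← Matrix.mul_assoc, hDV, Matrix.mul_assoc, hVD]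
    simp only [Matrix.mul_assoc]
  rw [hDt, h2, ← two_smul ℝ D, hD, smul_smul]
  norm_num

/-! ### Block diagonal matrices, written with orthogonal projections. -/

section BlockDiagonal

variable {m k ι : Type*} [Fintype m] [DecidableEq ι] {s : Finset ι} {P F : ι → Matrix m m ℝ}

theorem proj_mul_mul_of_ne (hP : ∀ i ∈ s, ∀ j ∈ s, P i * P j = if i = j then P i else 0)
    (hF : ∀ i ∈ s, P i * F i = F i * P i) {i j : ι} (hi : i ∈ s) (hj : j ∈ s) (hij : i ≠ j) :
    P i * F i * P j = 0 := by
  rw [hF i hi, Matrix.mul_assoc, hP i hi j hj, if_neg hij, Matrix.mul_zero]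

theorem proj_mul_mul_self (hP : ∀ i ∈ s, ∀ j ∈ s, P i * P j = if i = j then P i else 0)
    (hF : ∀ i ∈ s, P i * F i = F i * P i) {i : ι} (hi : i ∈ s) :
    P i * F i * P i = P i * F i := by
  rw [hF i hi, Matrix.mul_assoc, hP i hi i hi, if_pos rfl]

variable [DecidableEq m]

theorem proj_mul_blockDiag (hP : ∀ i ∈ s, ∀ j ∈ s, P i * P j = if i = j then P i else 0)
    {i : ι} (hi : i ∈ s) :
    P i * (∑ j ∈ s, P j * F j + (1 - ∑ j ∈ s, P j)) = P i * F i := by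
  have h1 : P i * ∑ j ∈ s, P j * F j = P i * F i := by
    rw [Finset.mul_sum, Finset.sum_eq_single_of_mem i hi]
    · rw [← Matrix.mul_assoc, hP i hi i hi, if_pos rfl]
    · intro j hj hji
      rw [← Matrix.mul_assoc, hP i hi j hj, if_neg hji.symm, Matrix.zero_mul]
  have h2 : P i * ∑ j ∈ s, P j = P i := by
    rw [Finset.mul_sum, Finset.sum_eq_single_of_mem i hi]
    · rw [hP i hi i hi, if_pos rfl]
    · intro j hj hji
      rw [hP i hi j hj, if_neg hji.symm]
  rw [Matrix.mul_add, Matrix.mul_sub, Matrix.mul_one, h1, h2, sub_self, add_zero]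

theorem blockDiag_mul_proj (hP : ∀ i ∈ s, ∀ j ∈ s, P i * P j = if i = j then P i else 0)
    (hF : ∀ i ∈ s, P i * F i = F i * P i) {i : ι} (hi : i ∈ s) :
    (∑ j ∈ s, P j * F j + (1 - ∑ j ∈ s, P j)) * P i = P i * F i := by
  have h1 : (∑ j ∈ s, P j * F j) * P i = P i * F i := by
    rw [Finset.sum_mul, Finset.sum_eq_single_of_mem i hi]
    · exact proj_mul_mul_self hP hF hi
    · exact fun j hj hji => proj_mul_mul_of_ne hP hF hj hi hji
  have h2 : (∑ j ∈ s, P j) * P i = P i := by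
    rw [Finset.sum_mul, Finset.sum_eq_single_of_mem i hi]
    · rw [hP i hi i hi, if_pos rfl]
    · intro j hj hji
      rw [hP j hj i hi, if_neg hji]
  rw [Matrix.add_mul, Matrix.sub_mul, Matrix.one_mul, h1, h2, sub_self, add_zero]

theorem blockDiag_mul_sub (hP : ∀ i ∈ s, ∀ j ∈ s, P i * P j = if i = j then P i else 0)
    (hF : ∀ i ∈ s, P i * F i = F i * P i) :
    (∑ j ∈ s, P j * F j + (1 - ∑ j ∈ s, P j)) * (1 - ∑ j ∈ s, P j) = 1 - ∑ j ∈ s, P j := by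
  rw [Matrix.mul_sub, Matrix.mul_one, Finset.mul_sum,
    Finset.sum_congr rfl fun i hi => blockDiag_mul_proj hP hF hi, add_sub_cancel_left]

theorem blockDiag_mul_transpose (hP : ∀ i ∈ s, ∀ j ∈ s, P i * P j = if i = j then P i else 0)
    (hPt : ∀ i ∈ s, (P i)ᵀ = P i) (hF : ∀ i ∈ s, P i * F i = F i * P i) :
    (∑ j ∈ s, P j * F j + (1 - ∑ j ∈ s, P j)) * (∑ j ∈ s, P j * F j + (1 - ∑ j ∈ s, P j))ᵀ =
      ∑ j ∈ s, P j * (F j * (F j)ᵀ) * P j + (1 - ∑ j ∈ s, P j) := by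
  have ht : (∑ j ∈ s, P j * F j + (1 - ∑ j ∈ s, P j))ᵀ =
      ∑ j ∈ s, P j * (P j * F j)ᵀ + (1 - ∑ j ∈ s, P j) := by
    rw [transpose_add, transpose_sub, transpose_one, transpose_sum, transpose_sum,
      Finset.sum_congr rfl hPt]
    congr 1
    refine Finset.sum_congr rfl fun i hi => ?_
    conv_lhs => rw [← proj_mul_mul_self hP hF hi]
    rw [transpose_mul, hPt i hi]
  rw [ht, Matrix.mul_add, blockDiag_mul_sub hP hF, Finset.mul_sum]
  congr 1
  refine Finset.sum_congr rfl fun i hi => ?_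
  rw [← Matrix.mul_assoc, blockDiag_mul_proj hP hF hi, transpose_mul, hPt i hi]
  simp only [Matrix.mul_assoc]

theorem blockDiag_mul_sum (hP : ∀ i ∈ s, ∀ j ∈ s, P i * P j = if i = j then P i else 0)
    (hF : ∀ i ∈ s, P i * F i = F i * P i) {V : ι → Matrix m k ℝ}
    (hV : ∀ i ∈ s, P i * V i = V i) :
    (∑ j ∈ s, P j * F j + (1 - ∑ j ∈ s, P j)) * ∑ i ∈ s, V i = ∑ i ∈ s, F i * V i := by
  rw [Matrix.mul_sum]
  refine Finset.sum_congr rfl fun i hi => ?_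
  conv_lhs => rw [← hV i hi, ← Matrix.mul_assoc, blockDiag_mul_proj hP hF hi, hF i hi,
    Matrix.mul_assoc, hV i hi]

theorem inv_comm_of_comm {Q X : Matrix m m ℝ} (hX : IsUnit X) (h : Q * X = X * Q) :
    Q * X⁻¹ = X⁻¹ * Q := by
  have hd := (isUnit_iff_isUnit_det X).1 hX
  calc Q * X⁻¹ = X⁻¹ * X * Q * X⁻¹ := by rw [nonsing_inv_mul _ hd, Matrix.one_mul]
    _ = X⁻¹ * (Q * X) * X⁻¹ := by rw [h]; simp only [Matrix.mul_assoc]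
    _ = X⁻¹ * Q := by
      rw [Matrix.mul_assoc, Matrix.mul_assoc, mul_nonsing_inv _ hd, Matrix.mul_one]

/-- The inverse is the block diagonal matrix of the inverses. -/
theorem isUnit_blockDiag (hP : ∀ i ∈ s, ∀ j ∈ s, P i * P j = if i = j then P i else 0)
    (hF : ∀ i ∈ s, P i * F i = F i * P i) (hu : ∀ i ∈ s, IsUnit (F i)) :
    IsUnit (∑ j ∈ s, P j * F j + (1 - ∑ j ∈ s, P j)) := by
  refine IsUnit.of_mul_eq_one (∑ j ∈ s, P j * (F j)⁻¹ + (1 - ∑ j ∈ s, P j)) ?_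
  rw [Matrix.mul_add, blockDiag_mul_sub hP hF, Finset.mul_sum,
    Finset.sum_congr rfl (g := P), add_sub_cancel]
  intro i hi
  rw [← Matrix.mul_assoc, blockDiag_mul_proj hP hF hi, Matrix.mul_assoc,
    mul_nonsing_inv _ ((isUnit_iff_isUnit_det _).1 (hu i hi)), Matrix.mul_one]

end BlockDiagonal

end Matrix

/-! ### Recursive choice along the tree, and coordinate projections. -/

/-- Recursion with a choice at each step: `R` ties the value at `p` to those at its predecessors,
and `Q` is the invariant that keeps the next choice possible. By `hloc` the default value at
non-predecessors is harmless. It serves both upwards (block factors) and downwards (middle factors).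
-/
theorem WellFounded.exists_rec {N α : Type*} [Inhabited α] {rel : N → N → Prop}
    (wf : WellFounded rel) (R : N → (N → α) → α → Prop) (Q : N → α → Prop)
    (hloc : ∀ p f g x, (∀ i, rel i p → f i = g i) → R p f x → R p g x)
    (hstep : ∀ p f, (∀ i, rel i p → Q i (f i)) → ∃ x, R p f x ∧ Q p x) :
    ∃ F : N → α, ∀ p, R p F (F p) ∧ Q p (F p) := by
  classical
  let step : (p : N) → ((i : N) → rel i p → α) → α := fun p f =>
    Classical.epsilon fun x => R p (fun i => if h : rel i p then f i h else default) x ∧ Q p x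
  refine ⟨wf.fix step, fun p => ?_⟩
  induction p using wf.induction with
  | _ p ih =>
    have hf := Classical.epsilon_spec (hstep p
      (fun i => if rel i p then wf.fix step i else default)
      fun i hi => by rw [if_pos hi]; exact (ih i hi).2)
    rw [wf.fix_eq]
    exact ⟨hloc p _ _ _ (fun i hi => if_pos hi) hf.1, hf.2⟩

namespace PartitionTree

open Matrix

variable {N : Type*} {n : ℕ}

/-- The distance to the root strictly decreases from a node to its parent. -/
theorem wellFounded_parent (T : PartitionTree N n) : WellFounded fun q p => T.IsChild p q := by
  classical
  refine Subrelation.wf (r := fun q p => Nat.find (T.reaches_root q) < Nat.find (T.reaches_root p))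
    ?_ (InvImage.wf _ Nat.lt_wfRel.wf)
  rintro q p ⟨hp, rfl⟩
  obtain ⟨k, hk⟩ : ∃ k, Nat.find (T.reaches_root p) = k + 1 := by
    refine Nat.exists_eq_succ_of_ne_zero fun h => hp ?_
    simpa [h] using Nat.find_spec (T.reaches_root p)
  have h := Nat.find_spec (T.reaches_root p)
  rw [hk, Function.iterate_succ_apply] at h
  rw [hk]
  exact Nat.lt_succ_of_le (Nat.find_min' _ h)

/-- Well-foundedness towards the root excludes cycles, and on a finite type an acyclic relation is
well-founded in both directions. -/
theorem wellFounded_isChild [Finite N] (T : PartitionTree N n) :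
    WellFounded fun i p => T.IsChild i p := by
  have h : WellFounded (Relation.TransGen fun q p => T.IsChild p q) :=
    T.wellFounded_parent.transGen
  have hirr : Std.Irrefl (Relation.TransGen fun i p => T.IsChild i p) :=
    ⟨fun a ha => h.irrefl.irrefl a (Relation.transGen_swap.1 ha)⟩
  exact Subrelation.wf (fun h => Relation.TransGen.single h)
    (Finite.wellFounded_of_trans_of_irrefl (Relation.TransGen fun i p => T.IsChild i p))

/-- The inclusion of the coordinates in the index subset of `i`. -/
def emb (T : PartitionTree N n) (i : N) : Matrix (Fin n) (T.index i) ℝ :=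
  (1 : Matrix (Fin n) (Fin n) ℝ).submatrix id Subtype.val

/-- The orthogonal projection onto the coordinates in the index subset of `i`. -/
def proj (T : PartitionTree N n) (i : N) : Matrix (Fin n) (Fin n) ℝ :=
  diagonal fun x => if x ∈ T.index i then 1 else 0

variable (T : PartitionTree N n)

theorem emb_transpose_mul_mul_emb (M : Matrix (Fin n) (Fin n) ℝ) (i j : N) :
    (T.emb i)ᵀ * M * T.emb j = T.block M i j := by
  ext x y
  simp [emb, block, Matrix.mul_apply, Matrix.one_apply]

theorem emb_transpose_mul_emb (i : N) : (T.emb i)ᵀ * T.emb i = 1 := by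
  have h := T.emb_transpose_mul_mul_emb 1 i i
  rw [Matrix.mul_one] at h
  rw [h, block, submatrix_one _ Subtype.val_injective]

theorem emb_mul_emb_transpose (i : N) : T.emb i * (T.emb i)ᵀ = T.proj i := by
  ext x y
  simp only [emb, proj, Matrix.mul_apply, Matrix.submatrix_apply, transpose_apply,
    Matrix.one_apply, id, diagonal_apply]
  by_cases hx : x ∈ T.index i
  · rw [Finset.sum_eq_single (⟨x, hx⟩ : T.index i)]
    · simp [hx, eq_comm]
    · intro b _ hb
      rw [if_neg (fun h => hb (Subtype.ext h.symm)), zero_mul]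
    · simp
  · rw [Finset.sum_eq_zero]
    · simp [hx]
    · intro b _
      rw [if_neg (fun h : x = b.1 => hx (h ▸ b.2)), zero_mul]

theorem emb_transpose_mul_emb_mul {r : ℕ} {i p : N} (h : T.IsChild i p)
    (M : Matrix (T.index p) (Fin r) ℝ) :
    (T.emb i)ᵀ * (T.emb p * M) = M.submatrix (T.incl h) id := by
  have h1 : (T.emb i)ᵀ * T.emb p = (1 : Matrix (T.index p) (T.index p) ℝ).submatrix (T.incl h) id := by
    ext x y
    simp [emb, incl, Matrix.mul_apply, Matrix.one_apply, Subtype.ext_iff]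
  rw [← Matrix.mul_assoc, h1]
  ext x y
  simp [Matrix.mul_apply, Matrix.one_apply]

theorem proj_mul_self (i : N) : T.proj i * T.proj i = T.proj i := by
  simp [proj, diagonal_mul_diagonal]

theorem one_sub_proj_mul_self (i : N) : (1 - T.proj i) * (1 - T.proj i) = 1 - T.proj i := by
  rw [Matrix.sub_mul, Matrix.one_mul, Matrix.mul_sub, Matrix.mul_one, proj_mul_self, sub_self,
    sub_zero]

theorem proj_transpose (i : N) : (T.proj i)ᵀ = T.proj i := diagonal_transpose _

theorem proj_mul_emb (i : N) : T.proj i * T.emb i = T.emb i := by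
  rw [← emb_mul_emb_transpose, Matrix.mul_assoc, emb_transpose_mul_emb, Matrix.mul_one]

theorem emb_transpose_mul_proj (i : N) : (T.emb i)ᵀ * T.proj i = (T.emb i)ᵀ := by
  rw [← transpose_inj, transpose_mul, proj_transpose, transpose_transpose, proj_mul_emb]

theorem proj_root : T.proj T.root = 1 := by
  simp [proj, T.index_root]

theorem proj_mul_proj_of_isChild {i p : N} (h : T.IsChild i p) :
    T.proj i * T.proj p = T.proj i := by
  rw [proj, proj, diagonal_mul_diagonal]
  congr 1
  ext x
  by_cases hx : x ∈ T.index i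
  · simp [hx, T.index_subset h hx]
  · simp [hx]

theorem proj_mul_proj_of_isChild' {i p : N} (h : T.IsChild i p) :
    T.proj p * T.proj i = T.proj i := by
  rw [← transpose_inj, transpose_mul, T.proj_transpose, T.proj_transpose,
    T.proj_mul_proj_of_isChild h]

theorem proj_mul_proj_of_ne {i j p : N} (hi : T.IsChild i p) (hj : T.IsChild j p) (hij : i ≠ j) :
    T.proj i * T.proj j = 0 := by
  rw [proj, proj, diagonal_mul_diagonal, diagonal_eq_zero]
  ext x
  by_cases hx : x ∈ T.index i
  · simp [Finset.disjoint_left.1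
      (T.disjoint_siblings i j hi.1 hj.1 (hi.2.trans hj.2.symm) hij) hx]
  · simp [hx]

theorem mem_children [Fintype N] {i p : N} : i ∈ T.children p ↔ T.IsChild i p := by
  simp [children]

theorem sum_proj [Fintype N] {p : N} (hp : ¬ T.IsLeaf p) :
    ∑ i ∈ T.children p, T.proj i = T.proj p := by
  simp only [IsLeaf, not_forall, not_not] at hp
  ext x y
  by_cases hxy : x = y
  swap
  · simp [Matrix.sum_apply, proj, hxy]
  subst hxy
  simp only [Matrix.sum_apply, proj, diagonal_apply_eq]
  by_cases hx : x ∈ T.index p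
  · obtain ⟨i, hi, hxi⟩ := (T.mem_index_iff p hp x).1 hx
    rw [Finset.sum_eq_single_of_mem i (T.mem_children.2 hi), if_pos hx, if_pos hxi]
    intro j hj hji
    have hj := T.mem_children.1 hj
    exact if_neg fun h => Finset.disjoint_left.1
      (T.disjoint_siblings j i hj.1 hi.1 (hj.2.trans hi.2.symm) hji) h hxi
  · rw [if_neg hx]
    exact Finset.sum_eq_zero fun i hi =>
      if_neg fun h => hx (T.index_subset (T.mem_children.1 hi) h)

/-- `L` is an invertible square root factor of `M` that respects the splitting of the coordinates
by the index subset of `i` and is the identity outside that subset. -/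
structure IsBlockFactor (i : N) (M L : Matrix (Fin n) (Fin n) ℝ) : Prop where
  mul_transpose : L * Lᵀ = M
  proj_mul : T.proj i * L = L * T.proj i
  mul_one_sub : L * (1 - T.proj i) = 1 - T.proj i
  isUnit : IsUnit L

/-- The embedding of a square matrix over the index subset of `i` as a diagonal block,
completed by the identity, has a square root factor of the same form. -/
theorem exists_isBlockFactor_emb (i : N) {B : Matrix (T.index i) (T.index i) ℝ} (hB : B.PosDef) :
    ∃ L : Matrix (Fin n) (Fin n) ℝ,
      T.IsBlockFactor i (T.emb i * B * (T.emb i)ᵀ + (1 - T.proj i)) L := by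
  obtain ⟨H, hH, hHB⟩ := hB.exists_symm_sq
  have hHt : Hᵀ = H := by
    have := hH.isHermitian.eq
    rwa [conjTranspose_eq_transpose_of_trivial] at this
  have hHu : IsUnit H.det := by
    have := (isUnit_iff_isUnit_det B).1 hB.isUnit
    rw [← hHB, det_mul] at this
    exact isUnit_of_mul_isUnit_left this
  have hPE := T.proj_mul_emb i
  have hEP := T.emb_transpose_mul_proj i
  have hmul : ∀ X Y : Matrix (T.index i) (T.index i) ℝ,
      (T.emb i * X * (T.emb i)ᵀ + (1 - T.proj i)) * (T.emb i * Y * (T.emb i)ᵀ + (1 - T.proj i)) =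
        T.emb i * (X * Y) * (T.emb i)ᵀ + (1 - T.proj i) := by
    intro X Y
    have h1 : T.emb i * X * (T.emb i)ᵀ * (T.emb i * Y * (T.emb i)ᵀ) =
        T.emb i * (X * Y) * (T.emb i)ᵀ := by
      calc _ = T.emb i * X * ((T.emb i)ᵀ * T.emb i) * Y * (T.emb i)ᵀ := by
            simp only [Matrix.mul_assoc]
        _ = _ := by rw [emb_transpose_mul_emb]; simp only [Matrix.mul_assoc, Matrix.mul_one]
    have h2 : T.emb i * X * (T.emb i)ᵀ * (1 - T.proj i) = 0 := by
      rw [Matrix.mul_sub, Matrix.mul_one, Matrix.mul_assoc _ _ (T.proj i), hEP, sub_self]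
    have h3 : (1 - T.proj i) * (T.emb i * Y * (T.emb i)ᵀ) = 0 := by
      rw [Matrix.sub_mul, Matrix.one_mul, ← Matrix.mul_assoc, ← Matrix.mul_assoc, hPE, sub_self]
    rw [Matrix.add_mul, Matrix.mul_add, Matrix.mul_add, h1, h2, h3, one_sub_proj_mul_self]
    abel
  refine ⟨T.emb i * H * (T.emb i)ᵀ + (1 - T.proj i), ?_, ?_, ?_, ?_⟩
  · have ht : (T.emb i * H * (T.emb i)ᵀ + (1 - T.proj i))ᵀ =
        T.emb i * H * (T.emb i)ᵀ + (1 - T.proj i) := by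
      simp only [transpose_add, transpose_sub, transpose_one, transpose_mul, transpose_transpose,
        hHt, proj_transpose, Matrix.mul_assoc]
    rw [ht, hmul, hHB]
  · rw [Matrix.mul_add, Matrix.add_mul, Matrix.mul_sub, Matrix.sub_mul, ← Matrix.mul_assoc,
      ← Matrix.mul_assoc, hPE, Matrix.mul_assoc _ _ (T.proj i), hEP, Matrix.mul_one,
      Matrix.one_mul]
  · rw [Matrix.add_mul, Matrix.mul_sub, Matrix.mul_one, Matrix.mul_assoc _ _ (T.proj i), hEP,
      sub_self, zero_add, one_sub_proj_mul_self]
  · refine IsUnit.of_mul_eq_one (T.emb i * H⁻¹ * (T.emb i)ᵀ + (1 - T.proj i)) ?_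
    rw [hmul, mul_nonsing_inv _ hHu, Matrix.mul_one, emb_mul_emb_transpose, add_sub_cancel]

end PartitionTree

/-! ### Block factors, from the leaves to the root. -/

namespace PartitionTree

open Matrix

variable {N : Type*} {n r : ℕ} (T : PartitionTree N n)

/-- The block of `A` that belongs to `i`, reduced by the low-rank term of the parent of `i` and
completed by the identity. -/
def reduced (A : Matrix (Fin n) (Fin n) ℝ) (U : N → Matrix (Fin n) (Fin r) ℝ)
    (S : N → Matrix (Fin r) (Fin r) ℝ) (i : N) : Matrix (Fin n) (Fin n) ℝ :=
  T.proj i * A * T.proj i - U i * S (T.parent i) * (U i)ᵀ + (1 - T.proj i)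

variable {T} {A : Matrix (Fin n) (Fin n) ℝ} {U : N → Matrix (Fin n) (Fin r) ℝ}
  {S W : N → Matrix (Fin r) (Fin r) ℝ}

/-- It keeps `V_i = F_i⁻¹ U_i` supported on the index subset of `i`. -/
theorem IsBlockFactor.proj_mul_inv_mul {k : Type*} {i : N} {M L : Matrix (Fin n) (Fin n) ℝ}
    (h : T.IsBlockFactor i M L) {X : Matrix (Fin n) k ℝ} (hX : T.proj i * X = X) :
    T.proj i * (L⁻¹ * X) = L⁻¹ * X := by
  rw [← Matrix.mul_assoc, inv_comm_of_comm h.isUnit h.proj_mul, Matrix.mul_assoc, hX]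

variable [Fintype N]

theorem eq_sum_children {p : N} (hp : ¬ T.IsLeaf p) (hU : T.proj p * U p = U p)
    (hUW : ∀ i, T.IsChild i p → T.proj i * U p = U i * W p) :
    U p = (∑ i ∈ T.children p, U i) * W p := by
  rw [← hU, ← T.sum_proj hp, Matrix.sum_mul, Matrix.sum_mul]
  exact Finset.sum_congr rfl fun i hi => hUW i (T.mem_children.1 hi)

theorem proj_mul_sum_children {p i : N} (hi : T.IsChild i p)
    {V : N → Matrix (Fin n) (Fin r) ℝ} (hV : ∀ j, T.IsChild j p → T.proj j * V j = V j) :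
    T.proj i * ∑ j ∈ T.children p, V j = V i := by
  rw [Matrix.mul_sum, Finset.sum_eq_single_of_mem i (T.mem_children.2 hi), hV i hi]
  intro j hj hji
  rw [← hV j (T.mem_children.1 hj), ← Matrix.mul_assoc,
    T.proj_mul_proj_of_ne hi (T.mem_children.1 hj) hji.symm, Matrix.zero_mul]

theorem proj_parent_mul_sum_children {p : N}
    {V : N → Matrix (Fin n) (Fin r) ℝ} (hV : ∀ j, T.IsChild j p → T.proj j * V j = V j) :
    T.proj p * ∑ j ∈ T.children p, V j = ∑ j ∈ T.children p, V j := by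
  rw [Matrix.mul_sum]
  refine Finset.sum_congr rfl fun i hi => ?_
  have hi := T.mem_children.1 hi
  conv_lhs => rw [← hV i hi, ← Matrix.mul_assoc, T.proj_mul_proj_of_isChild' hi, hV i hi]

/-- Siblings have disjoint supports, so the cross terms vanish. This identifies `Ξ_p` with the Gram
matrix in the Riccati equation. -/
theorem gram_sum_children {p : N}
    {V : N → Matrix (Fin n) (Fin r) ℝ} (hV : ∀ j, T.IsChild j p → T.proj j * V j = V j) :
    (∑ j ∈ T.children p, V j)ᵀ * ∑ j ∈ T.children p, V j =
      ∑ j ∈ T.children p, (V j)ᵀ * V j := by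
  rw [transpose_sum, Matrix.sum_mul]
  refine Finset.sum_congr rfl fun i hi => ?_
  have hi := T.mem_children.1 hi
  conv_lhs => rw [← hV i hi, transpose_mul, T.proj_transpose, Matrix.mul_assoc,
    proj_mul_sum_children hi hV]

theorem proj_mul_proj_children [DecidableEq N] (p : N) :
    ∀ i ∈ T.children p, ∀ j ∈ T.children p,
      T.proj i * T.proj j = if i = j then T.proj i else 0 := by
  intro i hi j hj
  split_ifs with h
  · rw [← h, T.proj_mul_self]
  · exact T.proj_mul_proj_of_ne (T.mem_children.1 hi) (T.mem_children.1 hj) h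

/-- The reduced block of a nonleaf node is a low-rank perturbation of the block diagonal matrix
formed by the reduced blocks of its children. -/
theorem reduced_eq {p : N} (hp : ¬ T.IsLeaf p) (hU : ∀ i, T.proj i * U i = U i)
    (hUW : ∀ i, T.IsChild i p → T.proj i * U p = U i * W p)
    (hAU : ∀ i j, T.IsChild i p → T.IsChild j p → i ≠ j →
      T.proj i * A * T.proj j = U i * S p * (U j)ᵀ) :
    T.reduced A U S p =
      ∑ i ∈ T.children p, T.proj i * T.reduced A U S i * T.proj i + (1 - T.proj p) +
        (∑ i ∈ T.children p, U i) * (S p - W p * S (T.parent p) * (W p)ᵀ) *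
          (∑ i ∈ T.children p, U i)ᵀ := by
  classical
  have hblock : ∀ i ∈ T.children p, T.proj i * T.reduced A U S i * T.proj i =
      T.proj i * A * T.proj i - U i * S p * (U i)ᵀ := by
    intro i hi
    have hUt : (U i)ᵀ * T.proj i = (U i)ᵀ := by
      rw [← transpose_inj, transpose_mul, transpose_transpose, T.proj_transpose, hU]
    have h0 : T.proj i * (1 - T.proj i) = 0 := by
      rw [Matrix.mul_sub, Matrix.mul_one, T.proj_mul_self, sub_self]
    rw [reduced, (T.mem_children.1 hi).2, Matrix.mul_add, h0, add_zero, Matrix.mul_sub,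
      Matrix.sub_mul]
    congr 1
    · rw [← Matrix.mul_assoc, ← Matrix.mul_assoc, T.proj_mul_self, Matrix.mul_assoc,
        T.proj_mul_self]
    · rw [← Matrix.mul_assoc, ← Matrix.mul_assoc, hU, Matrix.mul_assoc _ _ (T.proj i), hUt]
  -- Off the diagonal the low-rank term reproduces `A` exactly; on the diagonal it is subtracted
  -- again.
  have hsum : T.proj p * A * T.proj p =
      ∑ i ∈ T.children p, (T.proj i * A * T.proj i - U i * S p * (U i)ᵀ) +
        (∑ i ∈ T.children p, U i) * S p * (∑ i ∈ T.children p, U i)ᵀ := by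
    rw [← T.sum_proj hp, Finset.sum_mul, Finset.sum_mul, transpose_sum, Matrix.sum_mul,
      Matrix.sum_mul, ← Finset.sum_add_distrib]
    refine Finset.sum_congr rfl fun i hi => ?_
    rw [Finset.mul_sum, Matrix.mul_sum, ← sub_eq_iff_eq_add, ← Finset.sum_sub_distrib]
    refine Finset.sum_eq_single_of_mem i hi fun j hj hji => ?_
    rw [hAU i j (T.mem_children.1 hi) (T.mem_children.1 hj) hji.symm, sub_self]
  rw [Finset.sum_congr rfl hblock, reduced, hsum, eq_sum_children hp (hU p) hUW]
  simp only [Matrix.mul_sub, Matrix.sub_mul, transpose_mul, Matrix.mul_assoc]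
  abel

/-- The block factor of a nonleaf node is a low-rank perturbation of the block diagonal matrix
formed by the block factors of its children, whose middle factor solves a Riccati equation. -/
theorem exists_isBlockFactor_of_children {p : N} (hp : ¬ T.IsLeaf p)
    (hU : ∀ i, T.proj i * U i = U i) (hS : ∀ q, (S q).IsSymm)
    (hUW : ∀ i, T.IsChild i p → T.proj i * U p = U i * W p)
    (hAU : ∀ i j, T.IsChild i p → T.IsChild j p → i ≠ j →
      T.proj i * A * T.proj j = U i * S p * (U j)ᵀ)
    (hpos : (T.reduced A U S p).PosDef) {F : N → Matrix (Fin n) (Fin n) ℝ}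
    {V : N → Matrix (Fin n) (Fin r) ℝ}
    (hF : ∀ i, T.IsChild i p → T.IsBlockFactor i (T.reduced A U S i) (F i))
    (hV : ∀ i, T.IsChild i p → V i = (F i)⁻¹ * U i) :
    ∃ D : Matrix (Fin r) (Fin r) ℝ, D.IsSymm ∧
      S p - W p * S (T.parent p) * (W p)ᵀ =
        D + Dᵀ + D * (∑ i ∈ T.children p, (V i)ᵀ * V i) * Dᵀ ∧
      T.IsBlockFactor p (T.reduced A U S p)
        (∑ i ∈ T.children p, T.proj i * F i + (1 - T.proj p) +
          (∑ i ∈ T.children p, U i) * D * (∑ i ∈ T.children p, V i)ᵀ) ∧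
      IsUnit (1 + D * ∑ i ∈ T.children p, (V i)ᵀ * V i) ∧
      (∑ i ∈ T.children p, T.proj i * F i + (1 - T.proj p) +
          (∑ i ∈ T.children p, U i) * D * (∑ i ∈ T.children p, V i)ᵀ) *
        ∑ i ∈ T.children p, V i =
      (∑ i ∈ T.children p, U i) * (1 + D * ∑ i ∈ T.children p, (V i)ᵀ * V i) := by
  classical
  have hPV : ∀ i, T.IsChild i p → T.proj i * V i = V i := fun i hi => by
    rw [hV i hi, (hF i hi).proj_mul_inv_mul (hU i)]
  have hPP := T.proj_mul_proj_children p
  have hFc : ∀ i ∈ T.children p, T.proj i * F i = F i * T.proj i := fun i hi =>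
    (hF i (T.mem_children.1 hi)).proj_mul
  have hFu : ∀ i ∈ T.children p, IsUnit (F i) := fun i hi => (hF i (T.mem_children.1 hi)).isUnit
  have hsum := T.sum_proj hp
  have hEu := isUnit_blockDiag hPP hFc hFu
  have hEt := blockDiag_mul_transpose hPP (fun i _ => T.proj_transpose i) hFc
  have hEV := blockDiag_mul_sum (V := V) hPP hFc fun i hi => hPV i (T.mem_children.1 hi)
  have hE1 := blockDiag_mul_sub hPP hFc
  rw [hsum] at hEu hEt hEV hE1
  have hFV : ∑ i ∈ T.children p, F i * V i = ∑ i ∈ T.children p, U i := by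
    refine Finset.sum_congr rfl fun i hi => ?_
    rw [hV i (T.mem_children.1 hi), ← Matrix.mul_assoc,
      mul_nonsing_inv _ ((isUnit_iff_isUnit_det _).1 (hFu i hi)), Matrix.one_mul]
  rw [hFV] at hEV
  have hEP : T.proj p * (∑ i ∈ T.children p, T.proj i * F i + (1 - T.proj p)) =
      (∑ i ∈ T.children p, T.proj i * F i + (1 - T.proj p)) * T.proj p := by
    have h1 : (∑ i ∈ T.children p, T.proj i * F i + (1 - T.proj p)) * T.proj p =
        ∑ i ∈ T.children p, T.proj i * F i := by
      rw [Matrix.mul_sub, Matrix.mul_one, sub_eq_iff_eq_add'] at hE1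
      exact (add_right_cancel hE1).symm
    rw [h1, Matrix.mul_add, Matrix.mul_sub, Matrix.mul_one, T.proj_mul_self, sub_self, add_zero,
      Finset.mul_sum]
    refine Finset.sum_congr rfl fun i hi => ?_
    rw [← Matrix.mul_assoc, T.proj_mul_proj_of_isChild' (T.mem_children.1 hi)]
  have hred := T.reduced_eq hp hU hUW hAU
  rw [Finset.sum_congr rfl fun i hi => by
    rw [← (hF i (T.mem_children.1 hi)).mul_transpose], ← hEt] at hred
  have hPVs := proj_parent_mul_sum_children hPV
  have hPUs := proj_parent_mul_sum_children fun i (_ : T.IsChild i p) => hU i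
  rw [← gram_sum_children hPV]
  set E := ∑ i ∈ T.children p, T.proj i * F i + (1 - T.proj p) with hE
  set Us := ∑ i ∈ T.children p, U i
  set Vs := ∑ i ∈ T.children p, V i
  set L := S p - W p * S (T.parent p) * (W p)ᵀ with hL
  have hLs : L.IsSymm := by
    rw [IsSymm, hL]
    simp only [transpose_sub, transpose_mul, transpose_transpose, (hS _).eq, Matrix.mul_assoc]
  -- Here `Us = E Vs` pulls `E` out of the low-rank term.
  have hred' : T.reduced A U S p = E * (1 + Vs * L * Vsᵀ) * Eᵀ := by
    rw [hred, ← hEV, transpose_mul]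
    simp only [Matrix.mul_add, Matrix.add_mul, Matrix.mul_one, Matrix.mul_assoc]
  have hEd := (isUnit_iff_isUnit_det _).1 hEu
  -- Congruence with `E⁻¹` transfers positive definiteness from the reduced block.
  have hpos' : (1 + Vs * L * Vsᵀ).PosDef := by
    have h := hpos.mul_mul_conjTranspose_same (B := E⁻¹)
      (vecMul_injective_of_isUnit ((isUnit_nonsing_inv_iff).2 hEu))
    rw [conjTranspose_eq_transpose_of_trivial, hred'] at h
    have h2 : E⁻¹ * (E * (1 + Vs * L * Vsᵀ) * Eᵀ) * (E⁻¹)ᵀ = 1 + Vs * L * Vsᵀ := by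
      have h3 : Eᵀ * (E⁻¹)ᵀ = 1 := by
        rw [← transpose_mul, nonsing_inv_mul _ hEd, transpose_one]
      calc _ = E⁻¹ * E * (1 + Vs * L * Vsᵀ) * (Eᵀ * (E⁻¹)ᵀ) := by simp only [Matrix.mul_assoc]
        _ = _ := by rw [h3, nonsing_inv_mul _ hEd, Matrix.one_mul, Matrix.mul_one]
    rwa [h2] at h
  obtain ⟨D, hD, hric⟩ := exists_symm_riccati hLs Vs hpos'
  have hsq := one_add_mul_mul_transpose_sq Vs hric
  have hu : IsUnit (1 + Vs * D * Vsᵀ) := by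
    rw [← hsq] at hpos'
    exact isUnit_of_mul_transpose_posDef hpos'
  have hX : E + Us * D * Vsᵀ = E * (1 + Vs * D * Vsᵀ) := by
    rw [← hEV, Matrix.mul_add, Matrix.mul_one]
    simp only [Matrix.mul_assoc]
  have hVsP : Vsᵀ * T.proj p = Vsᵀ := by
    rw [← transpose_inj, transpose_mul, transpose_transpose, T.proj_transpose, hPVs]
  refine ⟨D, hD, hric, ⟨?_, ?_, ?_, ?_⟩, isUnit_one_add_mul_gram Vs hu, ?_⟩
  · rw [hX, transpose_mul, hred', ← hsq]
    simp only [Matrix.mul_assoc]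
  · rw [Matrix.mul_add, Matrix.add_mul, hEP, Matrix.mul_assoc _ _ (T.proj p), hVsP,
      ← Matrix.mul_assoc, ← Matrix.mul_assoc, hPUs]
  · rw [Matrix.add_mul, hE1, Matrix.mul_assoc _ _ (1 - T.proj p), Matrix.mul_sub, hVsP,
      Matrix.mul_one, sub_self, Matrix.mul_zero, add_zero]
  · rw [hX]
    exact hEu.mul hu
  · rw [Matrix.add_mul, hEV, Matrix.mul_add, Matrix.mul_one]
    simp only [Matrix.mul_assoc]

/-- A recursive family of block factors. -/
theorem exists_blockFactors
    (hU : ∀ i, T.proj i * U i = U i) (hS : ∀ q, (S q).IsSymm)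
    (hUW : ∀ i p, T.IsChild i p → T.proj i * U p = U i * W p)
    (hAU : ∀ i j p, T.IsChild i p → T.IsChild j p → i ≠ j →
      T.proj i * A * T.proj j = U i * S p * (U j)ᵀ)
    (hB : ∀ i, ∃ L, T.IsBlockFactor i (T.reduced A U S i) L) :
    ∃ (F : N → Matrix (Fin n) (Fin n) ℝ) (V : N → Matrix (Fin n) (Fin r) ℝ)
      (D Z : N → Matrix (Fin r) (Fin r) ℝ),
      (∀ i, T.IsBlockFactor i (T.reduced A U S i) (F i)) ∧
      (∀ i, T.proj i * V i = V i) ∧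
      (∀ i p, T.IsChild i p → T.proj i * V p = V i * Z p) ∧
      ∀ p, ¬ T.IsLeaf p → (D p).IsSymm ∧
        S p - W p * S (T.parent p) * (W p)ᵀ =
          D p + (D p)ᵀ + D p * (∑ i ∈ T.children p, (V i)ᵀ * V i) * (D p)ᵀ ∧
        W p = (1 + D p * ∑ i ∈ T.children p, (V i)ᵀ * V i) * Z p ∧
        F p = ∑ i ∈ T.children p, T.proj i * F i + (1 - T.proj p) +
          (∑ i ∈ T.children p, U i) * D p * (∑ i ∈ T.children p, V i)ᵀ := by
  -- The value at `p` is the pair of `F_p` and `D_p`; the bases appear as `F_i⁻¹ U_i`.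
  obtain ⟨F, hF⟩ := T.wellFounded_isChild.exists_rec
    (fun p (f : N → Matrix (Fin n) (Fin n) ℝ × Matrix (Fin r) (Fin r) ℝ) x => ¬ T.IsLeaf p →
      x.2.IsSymm ∧
      S p - W p * S (T.parent p) * (W p)ᵀ =
        x.2 + x.2ᵀ + x.2 * (∑ i ∈ T.children p, ((f i).1⁻¹ * U i)ᵀ * ((f i).1⁻¹ * U i)) * x.2ᵀ ∧
      IsUnit (1 + x.2 * ∑ i ∈ T.children p, ((f i).1⁻¹ * U i)ᵀ * ((f i).1⁻¹ * U i)) ∧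
      x.1 * ∑ i ∈ T.children p, (f i).1⁻¹ * U i = (∑ i ∈ T.children p, U i) *
        (1 + x.2 * ∑ i ∈ T.children p, ((f i).1⁻¹ * U i)ᵀ * ((f i).1⁻¹ * U i)) ∧
      x.1 = ∑ i ∈ T.children p, T.proj i * (f i).1 + (1 - T.proj p) +
        (∑ i ∈ T.children p, U i) * x.2 * (∑ i ∈ T.children p, (f i).1⁻¹ * U i)ᵀ)
    (fun p x => T.IsBlockFactor p (T.reduced A U S p) x.1)
    (by
      intro p f g x hfg h hp
      have h := h hp
      have e1 : ∑ i ∈ T.children p, ((f i).1⁻¹ * U i)ᵀ * ((f i).1⁻¹ * U i) =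
          ∑ i ∈ T.children p, ((g i).1⁻¹ * U i)ᵀ * ((g i).1⁻¹ * U i) :=
        Finset.sum_congr rfl fun i hi => by rw [hfg i (T.mem_children.1 hi)]
      have e2 : ∑ i ∈ T.children p, (f i).1⁻¹ * U i = ∑ i ∈ T.children p, (g i).1⁻¹ * U i :=
        Finset.sum_congr rfl fun i hi => by rw [hfg i (T.mem_children.1 hi)]
      have e3 : ∑ i ∈ T.children p, T.proj i * (f i).1 =
          ∑ i ∈ T.children p, T.proj i * (g i).1 :=
        Finset.sum_congr rfl fun i hi => by rw [hfg i (T.mem_children.1 hi)]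
      rwa [e1, e2, e3] at h)
    (by
      intro p f hf
      -- A leaf takes `L` as its factor. At a nonleaf node `L` only witnesses that the reduced block
      -- is positive definite.
      obtain ⟨L, hL⟩ := hB p
      by_cases hp : T.IsLeaf p
      · exact ⟨(L, 0), fun h => absurd hp h, hL⟩
      · obtain ⟨D, hD, hric, hfac, hu, hXV⟩ := exists_isBlockFactor_of_children hp hU hS
          (fun i => hUW i p) (fun i j => hAU i j p)
          (hL.mul_transpose ▸ posDef_mul_transpose_of_isUnit hL.isUnit) hf (fun _ _ => rfl)
        exact ⟨(_, D), fun _ => ⟨hD, hric, hu, hXV, rfl⟩, hfac⟩)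
  have hPV : ∀ i, T.proj i * ((F i).1⁻¹ * U i) = (F i).1⁻¹ * U i :=
    fun i => (hF i).2.proj_mul_inv_mul (hU i)
  refine ⟨fun i => (F i).1, fun i => (F i).1⁻¹ * U i, fun i => (F i).2,
    fun p => (1 + (F p).2 * ∑ i ∈ T.children p, ((F i).1⁻¹ * U i)ᵀ * ((F i).1⁻¹ * U i))⁻¹ * W p,
    fun i => (hF i).2, hPV, ?_, ?_⟩
  · intro i p hi
    have hp : ¬ T.IsLeaf p := fun h => h i hi
    obtain ⟨-, -, hu, hXV, -⟩ := (hF p).1 hp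
    have hFu := (isUnit_iff_isUnit_det _).1 (hF p).2.isUnit
    -- Apply `F_p⁻¹` to `U_p = U W_p`, with `U` the sum over the children, and use `F_p V = U (1 +
    -- D_p Ξ_p)`.
    have hV : (F p).1⁻¹ * U p = (∑ i ∈ T.children p, (F i).1⁻¹ * U i) *
        ((1 + (F p).2 * ∑ i ∈ T.children p, ((F i).1⁻¹ * U i)ᵀ * ((F i).1⁻¹ * U i))⁻¹ * W p) := by
      rw [← Matrix.mul_assoc]
      set Y := 1 + (F p).2 * ∑ i ∈ T.children p, ((F i).1⁻¹ * U i)ᵀ * ((F i).1⁻¹ * U i)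
      have h1 : (∑ i ∈ T.children p, (F i).1⁻¹ * U i) * Y⁻¹ =
          (F p).1⁻¹ * ∑ i ∈ T.children p, U i := by
        have h2 : ∑ i ∈ T.children p, (F i).1⁻¹ * U i =
            (F p).1⁻¹ * ((∑ i ∈ T.children p, U i) * Y) := by
          rw [← hXV, ← Matrix.mul_assoc, nonsing_inv_mul _ hFu, Matrix.one_mul]
        rw [h2, Matrix.mul_assoc, Matrix.mul_assoc,
          mul_nonsing_inv _ ((isUnit_iff_isUnit_det _).1 hu), Matrix.mul_one]
      rw [h1, Matrix.mul_assoc, ← eq_sum_children hp (hU p) fun i => hUW i p]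
    simp only
    rw [hV, ← Matrix.mul_assoc, proj_mul_sum_children hi fun j _ => hPV j]
  · intro p hp
    obtain ⟨hD, hric, hu, -, hX⟩ := (hF p).1 hp
    refine ⟨hD, hric, ?_, hX⟩
    rw [← Matrix.mul_assoc, mul_nonsing_inv _ ((isUnit_iff_isUnit_det _).1 hu), Matrix.one_mul]

end PartitionTree

/-! ### Middle factors, from the root to the leaves. -/

namespace PartitionTree

open Matrix

variable {N : Type*} {n r : ℕ} {T : PartitionTree N n}

/-- The root is its own parent, so the equation there would be circular; `W T.root = 0` removes the
self-reference. -/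
theorem exists_middle_factors (D W Z : N → Matrix (Fin r) (Fin r) ℝ) (hW : W T.root = 0) :
    ∃ Om : N → Matrix (Fin r) (Fin r) ℝ,
      ∀ p, Om p = D p + W p * Om (T.parent p) * (Z p)ᵀ := by
  obtain ⟨Om, h⟩ := T.wellFounded_parent.exists_rec
    (fun p f x => x = D p + W p * f (T.parent p) * (Z p)ᵀ) (fun _ _ => True)
    (by
      intro p f g x hfg hx
      by_cases hp : p = T.root
      · subst hp
        simpa [hW] using hx
      · rwa [← hfg (T.parent p) ⟨hp, rfl⟩])
    (fun p f _ => ⟨_, rfl, trivial⟩)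
  exact ⟨Om, fun p => (h p).1⟩

variable [Fintype N] {U V : N → Matrix (Fin n) (Fin r) ℝ} {F : N → Matrix (Fin n) (Fin n) ℝ}
  {D W Z Om : N → Matrix (Fin r) (Fin r) ℝ}

/-- The blocks of the factor at the root between children of `p`, once its block at `p` is
known. -/
theorem proj_mul_root_mul_proj {G : Matrix (Fin n) (Fin n) ℝ} {p : N}
    (hU : ∀ i, T.proj i * U i = U i) (hV : ∀ i, T.proj i * V i = V i)
    (hUW : ∀ i, T.IsChild i p → T.proj i * U p = U i * W p)
    (hVZ : ∀ i, T.IsChild i p → T.proj i * V p = V i * Z p)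
    (hF : F p = ∑ i ∈ T.children p, T.proj i * F i + (1 - T.proj p) +
      (∑ i ∈ T.children p, U i) * D p * (∑ i ∈ T.children p, V i)ᵀ)
    (hOm : Om p = D p + W p * Om (T.parent p) * (Z p)ᵀ)
    (hG : T.proj p * G * T.proj p = T.proj p * F p + U p * Om (T.parent p) * (V p)ᵀ)
    {i j : N} (hi : T.IsChild i p) (hj : T.IsChild j p) :
    T.proj i * G * T.proj j = T.proj i * F i * T.proj j + U i * Om p * (V j)ᵀ := by
  classical
  have hFd : T.proj i * (∑ i ∈ T.children p, T.proj i * F i + (1 - T.proj p)) =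
      T.proj i * F i := by
    have h := proj_mul_blockDiag (F := F) (T.proj_mul_proj_children p) (T.mem_children.2 hi)
    rwa [T.sum_proj fun h => h i hi] at h
  have hVs : (∑ i ∈ T.children p, V i)ᵀ * T.proj j = (V j)ᵀ := by
    rw [← transpose_inj, transpose_mul, transpose_transpose, T.proj_transpose,
      proj_mul_sum_children hj fun k _ => hV k, transpose_transpose]
  have hVp : (V p)ᵀ * T.proj j = (Z p)ᵀ * (V j)ᵀ := by
    rw [← transpose_mul, ← hVZ j hj, transpose_mul, T.proj_transpose]
  have hUs := proj_mul_sum_children (V := U) hi fun k _ => hU k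
  -- The case `i = j` is allowed: it carries the descent to the children, while `i ≠ j` yields the
  -- low-rank blocks.
  calc T.proj i * G * T.proj j = T.proj i * (T.proj p * G * T.proj p) * T.proj j := by
        rw [← Matrix.mul_assoc, ← Matrix.mul_assoc, T.proj_mul_proj_of_isChild hi,
          Matrix.mul_assoc _ (T.proj p), T.proj_mul_proj_of_isChild' hj]
    _ = T.proj i * F p * T.proj j + U i * W p * Om (T.parent p) * ((Z p)ᵀ * (V j)ᵀ) := by
        rw [hG, Matrix.mul_add, Matrix.add_mul, ← Matrix.mul_assoc (T.proj i) (T.proj p),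
          T.proj_mul_proj_of_isChild hi, ← hVp, ← hUW i hi]
        simp only [Matrix.mul_assoc]
    _ = _ := by
        rw [hF, Matrix.mul_add, Matrix.add_mul, hFd, ← Matrix.mul_assoc (T.proj i),
          ← Matrix.mul_assoc (T.proj i), hUs, Matrix.mul_assoc (U i * D p), hVs, hOm]
        simp only [Matrix.mul_add, Matrix.add_mul, Matrix.mul_assoc, add_assoc]

theorem proj_mul_root_mul_self {A : Matrix (Fin n) (Fin n) ℝ}
    {S : N → Matrix (Fin r) (Fin r) ℝ}
    (hU : ∀ i, T.proj i * U i = U i) (hV : ∀ i, T.proj i * V i = V i) (hU0 : U T.root = 0)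
    (hUW : ∀ i p, T.IsChild i p → T.proj i * U p = U i * W p)
    (hVZ : ∀ i p, T.IsChild i p → T.proj i * V p = V i * Z p)
    (hfac : ∀ i, T.IsBlockFactor i (T.reduced A U S i) (F i))
    (hF : ∀ p, ¬ T.IsLeaf p → F p = ∑ i ∈ T.children p, T.proj i * F i + (1 - T.proj p) +
      (∑ i ∈ T.children p, U i) * D p * (∑ i ∈ T.children p, V i)ᵀ)
    (hOm : ∀ p, Om p = D p + W p * Om (T.parent p) * (Z p)ᵀ) (i : N) :
    T.proj i * F T.root * T.proj i = T.proj i * F i + U i * Om (T.parent i) * (V i)ᵀ := by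
  induction i using T.wellFounded_parent.induction with
  | _ i ih =>
    by_cases h : i = T.root
    · rw [h, hU0, T.proj_root]
      simp
    · have hi : T.IsChild i (T.parent i) := ⟨h, rfl⟩
      rw [proj_mul_root_mul_proj hU hV (fun j => hUW j _) (fun j => hVZ j _)
        (hF _ fun h => h i hi) (hOm _) (ih _ hi) hi hi, (hfac i).proj_mul,
        Matrix.mul_assoc _ _ (T.proj i), T.proj_mul_self]

end PartitionTree

/-! ### Assembly of the factorization and the reduction to symmetric middle factors. -/

namespace PartitionTree

open Matrix

variable {N : Type*} {n r : ℕ} (T : PartitionTree N n)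

theorem proj_mul_mul_proj (M : Matrix (Fin n) (Fin n) ℝ) (i j : N) :
    T.proj i * M * T.proj j = T.emb i * T.block M i j * (T.emb j)ᵀ := by
  rw [← emb_transpose_mul_mul_emb, ← emb_mul_emb_transpose, ← emb_mul_emb_transpose]
  simp only [Matrix.mul_assoc]

theorem block_transpose (M : Matrix (Fin n) (Fin n) ℝ) (i j : N) :
    (T.block M i j)ᵀ = T.block Mᵀ j i := rfl

variable {T} {A : Matrix (Fin n) (Fin n) ℝ} {U : (i : N) → Matrix (T.index i) (Fin r) ℝ}
  {S W : N → Matrix (Fin r) (Fin r) ℝ}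

/-- The factorization for symmetric middle factors. -/
theorem exists_factorization_of_isSymm [Fintype N] (hfac : T.HasFactors A U U S W W)
    (hS : ∀ p, (S p).IsSymm) (hA : A.PosDef)
    (hB : ∀ i p, T.IsChild i p → (T.block A i i - U i * S p * (U i)ᵀ).PosDef) :
    ∃ (G : Matrix (Fin n) (Fin n) ℝ)
      (V : (i : N) → Matrix (T.index i) (Fin r) ℝ)
      (Om Z D : N → Matrix (Fin r) (Fin r) ℝ),
      T.HasFactors G U V Om W Z ∧ A = G * Gᵀ ∧
      ∀ p, ¬ T.IsLeaf p →
        (D p).IsSymm ∧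
        T.Lam S W p = D p + (D p)ᵀ + D p * T.Xi V p * (D p)ᵀ ∧
        (p = T.root → Om p = D p) ∧
        (p ≠ T.root →
          W p = (1 + D p * T.Xi V p) * Z p ∧
          Om p = D p + W p * Om (T.parent p) * (Z p)ᵀ) := by
  classical
  -- Root values of `U` and `W` are free. Setting them to zero makes the reduced matrix at the root
  -- equal to `A` and lets the formulas for `Λ` and `Ω` hold there without a case distinction.
  set U' : N → Matrix (Fin n) (Fin r) ℝ := fun i => if i = T.root then 0 else T.emb i * U i
    with hU'
  set W' : N → Matrix (Fin r) (Fin r) ℝ := fun i => if i = T.root then 0 else W i with hW'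
  have hU'0 : U' T.root = 0 := if_pos rfl
  have hW'0 : W' T.root = 0 := if_pos rfl
  have hU'1 : ∀ {i}, i ≠ T.root → U' i = T.emb i * U i := fun h => if_neg h
  have hW'1 : ∀ {i}, i ≠ T.root → W' i = W i := fun h => if_neg h
  have hU : ∀ i, T.proj i * U' i = U' i := by
    intro i
    by_cases h : i = T.root
    · rw [h, hU'0, Matrix.mul_zero]
    · rw [hU'1 h, ← Matrix.mul_assoc, T.proj_mul_emb]
  have hUW : ∀ i p, T.IsChild i p → T.proj i * U' p = U' i * W' p := by
    intro i p hi
    by_cases h : p = T.root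
    · rw [h, hU'0, hW'0, Matrix.mul_zero, Matrix.mul_zero]
    · rw [hU'1 h, hW'1 h, hU'1 hi.1, ← T.emb_mul_emb_transpose, Matrix.mul_assoc,
        T.emb_transpose_mul_emb_mul hi, (hfac.2 i p hi h).1, Matrix.mul_assoc]
  have hAU : ∀ i j p, T.IsChild i p → T.IsChild j p → i ≠ j →
      T.proj i * A * T.proj j = U' i * S p * (U' j)ᵀ := by
    intro i j p hi hj hij
    rw [T.proj_mul_mul_proj, hfac.1 i j p hi hj hij, hU'1 hi.1, hU'1 hj.1, transpose_mul]
    simp only [Matrix.mul_assoc]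
  have hfactor : ∀ i, ∃ L, T.IsBlockFactor i (T.reduced A U' S i) L := by
    intro i
    by_cases h : i = T.root
    · obtain ⟨L, hL⟩ := T.exists_isBlockFactor_emb i (B := T.block A i i)
        (hA.submatrix Subtype.val_injective)
      refine ⟨L, ?_⟩
      rw [reduced, T.proj_mul_mul_proj]
      rw [h] at hL ⊢
      rwa [hU'0, Matrix.zero_mul, Matrix.zero_mul, sub_zero]
    · obtain ⟨L, hL⟩ := T.exists_isBlockFactor_emb i (hB i _ ⟨h, rfl⟩)
      refine ⟨L, ?_⟩
      rw [reduced, T.proj_mul_mul_proj, hU'1 h, transpose_mul]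
      simp only [Matrix.mul_sub, Matrix.sub_mul, Matrix.mul_assoc] at hL ⊢
      exact hL
  obtain ⟨F, V, D, Z, hF, hV, hVZ, hrec⟩ := exists_blockFactors hU hS hUW hAU hfactor
  obtain ⟨Om, hOm⟩ := exists_middle_factors (T := T) D W' Z hW'0
  have hroot := proj_mul_root_mul_self hU hV hU'0 hUW hVZ hF (fun p hp => (hrec p hp).2.2.2) hOm
  have hXi : ∀ p, T.Xi (fun i => (T.emb i)ᵀ * V i) p = ∑ i ∈ T.children p, (V i)ᵀ * V i := by
    intro p
    refine Finset.sum_congr rfl fun i _ => ?_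
    rw [transpose_mul, transpose_transpose, Matrix.mul_assoc, ← Matrix.mul_assoc (T.emb i),
      T.emb_mul_emb_transpose, hV]
  refine ⟨F T.root, fun i => (T.emb i)ᵀ * V i, Om, Z, D, ⟨?_, ?_⟩, ?_, ?_⟩
  · intro i j p hi hj hij
    have h := proj_mul_root_mul_proj hU hV (fun i => hUW i p) (fun i => hVZ i p)
      (hrec p fun h => h i hi).2.2.2 (hOm p) (hroot p) hi hj
    -- `F_i` respects the splitting at `i`, so between distinct siblings only the low-rank term
    -- survives.
    rw [(hF i).proj_mul, Matrix.mul_assoc (F i), T.proj_mul_proj_of_ne hi hj hij,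
      Matrix.mul_zero, zero_add] at h
    have h2 : T.block (F T.root) i j = (T.emb i)ᵀ * (T.proj i * F T.root * T.proj j) * T.emb j := by
      rw [← T.emb_transpose_mul_mul_emb, ← Matrix.mul_assoc, ← Matrix.mul_assoc,
        T.emb_transpose_mul_proj, Matrix.mul_assoc _ (T.proj j), T.proj_mul_emb]
    rw [h2, h, hU'1 hi.1, transpose_mul, transpose_transpose]
    simp only [← Matrix.mul_assoc]
    rw [T.emb_transpose_mul_emb, Matrix.one_mul]
  · intro i p hi hp
    refine ⟨(hfac.2 i p hi hp).1, ?_⟩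
    rw [← T.emb_transpose_mul_emb_mul hi, ← Matrix.mul_assoc (T.emb p), T.emb_mul_emb_transpose,
      hV, Matrix.mul_assoc, ← hVZ i p hi, ← Matrix.mul_assoc, T.emb_transpose_mul_proj]
  · rw [(hF T.root).mul_transpose, reduced, hU'0, T.proj_root]
    simp
  · intro p hp
    obtain ⟨hD, hric, hWZ, -⟩ := hrec p hp
    rw [hXi]
    refine ⟨hD, ?_, ?_, ?_⟩
    · rw [← hric, Lam]
      split_ifs with h
      · rw [h, hW'0]
        simp
      · rw [hW'1 h]
    · intro h
      rw [hOm p, h, hW'0]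
      simp
    · intro h
      rw [← hW'1 h]
      exact ⟨hWZ, hOm p⟩

theorem block_sub_isSymm {i : N} {X : Matrix (T.index i) (T.index i) ℝ} (hA : A.PosDef)
    (h : (T.block A i i - X).PosDef) : X.IsSymm := by
  have h1 := h.isHermitian.eq
  have h2 := hA.isHermitian.eq
  rw [conjTranspose_eq_transpose_of_trivial] at h1 h2
  rw [transpose_sub, block_transpose, h2] at h1
  exact sub_right_injective h1

end PartitionTree

theorem theorem4 {N : Type*} [Fintype N] {n r : ℕ} (hr : 0 < r) (T : PartitionTree N n)
    (A : Matrix (Fin n) (Fin n) ℝ)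
    (U : (i : N) → Matrix (T.index i) (Fin r) ℝ)
    (S W : N → Matrix (Fin r) (Fin r) ℝ)
    (hfac : T.HasFactors A U U S W W)
    (hA : A.PosDef)
    (hB : ∀ i p, T.IsChild i p → (T.block A i i - U i * S p * (U i).transpose).PosDef) :
    ∃ (G : Matrix (Fin n) (Fin n) ℝ)
      (V : (i : N) → Matrix (T.index i) (Fin r) ℝ)
      (Om Z : N → Matrix (Fin r) (Fin r) ℝ),
      T.HasFactors G U V Om W Z ∧
      A = G * G.transpose ∧
      ((∀ p, ¬ T.IsLeaf p → (S p).IsSymm) →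
        ∃ D : N → Matrix (Fin r) (Fin r) ℝ,
          ∀ p, ¬ T.IsLeaf p →
            (D p).IsSymm ∧
            T.Lam S W p = D p + (D p).transpose + D p * T.Xi V p * (D p).transpose ∧
            (p = T.root → Om p = D p) ∧
            (p ≠ T.root →
              W p = (1 + D p * T.Xi V p) * Z p ∧
              Om p = D p + W p * Om (T.parent p) * (Z p).transpose)) := by
  have hAt := hA.isHermitian.eq
  rw [Matrix.conjTranspose_eq_transpose_of_trivial] at hAt
  -- Symmetric parts suffice: `A` is symmetric, which covers sibling blocks, and `U_i Σ_p U_iᵀ` is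
  -- symmetric as a difference of symmetric matrices.
  set S' : N → Matrix (Fin r) (Fin r) ℝ := fun p => (1 / 2 : ℝ) • (S p + (S p).transpose) with hS'
  have hhalf : ∀ {a b : Type _} (X : Matrix a b ℝ), (1 / 2 : ℝ) • (X + X) = X := fun X => by
    rw [← two_smul ℝ X, smul_smul]
    norm_num
  have hS'eq : ∀ i j p, U j * S p * (U i).transpose = (U i * S p * (U j).transpose).transpose →
      U i * S' p * (U j).transpose = U i * S p * (U j).transpose := by
    intro i j p h
    rw [← Matrix.transpose_inj, Matrix.transpose_transpose] at h
    simp only [Matrix.transpose_mul, Matrix.transpose_transpose, ← Matrix.mul_assoc] at h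
    simp only [hS', Matrix.mul_smul, Matrix.smul_mul, Matrix.mul_add, Matrix.add_mul]
    rw [h, hhalf]
  have hfac' : T.HasFactors A U U S' W W := by
    refine ⟨fun i j p hi hj hij => ?_, hfac.2⟩
    rw [hfac.1 i j p hi hj hij, hS'eq]
    rw [← hfac.1 i j p hi hj hij, ← hfac.1 j i p hj hi hij.symm, T.block_transpose, hAt]
  have hB' : ∀ i p, T.IsChild i p →
      (T.block A i i - U i * S' p * (U i).transpose).PosDef := by
    intro i p hi
    rw [hS'eq i i p (PartitionTree.block_sub_isSymm hA (hB i p hi)).symm]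
    exact hB i p hi
  have hS's : ∀ p, (S' p).IsSymm := fun p => by
    rw [Matrix.IsSymm, hS']
    simp only [Matrix.transpose_smul, Matrix.transpose_add, Matrix.transpose_transpose,
      add_comm]
  obtain ⟨G, V, Om, Z, D, hG, hAG, hD⟩ :=
    PartitionTree.exists_factorization_of_isSymm hfac' hS's hA hB'
  refine ⟨G, V, Om, Z, hG, hAG, fun hS => ⟨D, fun p hp => ?_⟩⟩
  have hSS : ∀ q, ¬ T.IsLeaf q → S' q = S q := fun q hq => by
    simp only [hS', (hS q hq).eq, hhalf]
  have hLam : T.Lam S' W p = T.Lam S W p := by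
    rw [PartitionTree.Lam, PartitionTree.Lam, hSS p hp]
    split_ifs with h
    · rfl
    -- The symmetry hypothesis covers nonleaf nodes only; the parent has `p` as a child.
    · rw [hSS (T.parent p) fun hl => hl p ⟨h, rfl⟩]
  rw [← hLam]
  exact hD p hp
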